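/- Let $C$ be a finite set of integers with $m=\#C$ elements. Write $C\equiv\{1,3\}\pmod 4$ if the set of residues modulo $4$ of the elements of $C$ is exactly $\{1,3\}$ (so all elements of $C$ are odd and $m\ge 2$). For an infinite word $A=a_1a_2a_3\cdots\in C^\infty$ put $$\Lambda(A)=\Big\{\sum_{k=1}^n 4^{k-1}\omega_k:\ \omega_k\in\{0,a_k\},\ n\ge 1\Big\}$$ and let $\Lambda_I(A)$ be the set of all $\lambda\in\mathbb Z$ for which there are $\omega_k\in\{0,a_k\}$ $(k\ge1)$ such that $\lambda\equiv\sum_{k=1}^n4^{k-1}\omega_k\pmod{4^n}$ for all $n\ge1$. Let $$\mathcal N(C)=\{A\in C^\infty:\ \Lambda(A)\ne\Lambda_I(A)\}.$$ Hausdorff dimension $\dim_H$ in $C^\infty$ is taken with respect to the metric $\rho(A,B)=m^{-\min\{n\ge1:\,a_n\ne b_n\}}$ for $A\neq B$, $\rho(A,A)=0$. Then the following hold. (i) There exists $C\equiv\{1,3\}\pmod 4$ such that $\mathcal N(C)$ is empty. (ii) For every $C\equiv\{1,3\}\pmod 4$, if $\mathcal N(C)$ is nonempty, then $\mathcal N(C)$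 is infinite. (iii) For $C=\{1,3\}$ (which satisfies $C\equiv\{1,3\}\pmod4$), $\mathcal N(C)$ is countably infinite. (iv) For every $\varepsilon>0$ there is an integer $r\ge1$ such that the set $C=\{1,\,3\sum_{n=0}^r4^n\}$ satisfies $C\equiv\{1,3\}\pmod4$ and $\dim_H\mathcal N(C)>1-\varepsilon$. -/

import Mathlib

/-- A finite digit set `C` of integers satisfies `C ≡ {1, 3} (mod 4)`: the set of residues of its
elements is exactly `{1, 3}`. In particular all elements are odd and `C` has at least two. -/
def CongrOneThree (C : Finset ℤ) : Prop :=
  C.image (fun c => c % 4) = {1, 3}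

/-- Special labels `A = a₁a₂a₃⋯ ∈ C^∞`. Letters are indexed from `0`:
`A.letter k` is `a_{k+1}`. -/
@[ext]
structure SpecialLabel (C : Finset ℤ) : Type where
  letter : ℕ → C

namespace SpecialLabel

variable {C : Finset ℤ}

open scoped Classical in
/-- The standard metric on the symbolic space over an alphabet of `m = #C` letters,
`ρ(A, B) = m ^ (-min {n ≥ 1 : aₙ ≠ bₙ})` for `A ≠ B` (the `n`-th letter is `A.letter (n - 1)`). -/
noncomputable instance : Dist (SpecialLabel C) where
  dist A B := if A = B then 0
    else ((C.card : ℝ)⁻¹) ^ (PiNat.firstDiff A.letter B.letter + 1)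

theorem dist_def_of_ne {A B : SpecialLabel C} (h : A ≠ B) :
    dist A B = ((C.card : ℝ)⁻¹) ^ (PiNat.firstDiff A.letter B.letter + 1) :=
  if_neg h

theorem card_pos (A : SpecialLabel C) : 0 < C.card :=
  Finset.card_pos.2 ⟨(A.letter 0 : ℤ), (A.letter 0).2⟩

theorem dist_nonneg' (A B : SpecialLabel C) : 0 ≤ dist A B := by
  by_cases h : A = B
  · exact (if_pos h).ge
  · rw [dist_def_of_ne h]
    positivity

theorem dist_triangle' (x y z : SpecialLabel C) : dist x z ≤ dist x y + dist y z := by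
  have hself : ∀ w : SpecialLabel C, dist w w = 0 := fun w => if_pos rfl
  by_cases hxz : x = z
  · subst hxz
    rw [hself]
    exact add_nonneg (dist_nonneg' _ _) (dist_nonneg' _ _)
  by_cases hxy : x = y
  · subst hxy
    rw [hself, zero_add]
  by_cases hyz : y = z
  · subst hyz
    rw [hself, add_zero]
  have hm : (1 : ℝ) ≤ C.card := by exact_mod_cast card_pos x
  have h0 : (0 : ℝ) ≤ (C.card : ℝ)⁻¹ := by positivity
  have h1 : (C.card : ℝ)⁻¹ ≤ 1 := inv_le_one_of_one_le₀ hm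
  have key := PiNat.min_firstDiff_le x.letter y.letter z.letter (fun h => hxz (SpecialLabel.ext h))
  rcases min_le_iff.1 key with h | h
  · have : dist x z ≤ dist x y := by
      rw [dist_def_of_ne hxz, dist_def_of_ne hxy]
      exact pow_le_pow_of_le_one h0 h1 (Nat.succ_le_succ h)
    linarith [dist_nonneg' y z]
  · have : dist x z ≤ dist y z := by
      rw [dist_def_of_ne hxz, dist_def_of_ne hyz]
      exact pow_le_pow_of_le_one h0 h1 (Nat.succ_le_succ h)
    linarith [dist_nonneg' x y]

noncomputable instance : MetricSpace (SpecialLabel C) where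
  dist_self A := if_pos rfl
  dist_comm A B := by
    by_cases h : A = B
    · rw [h]
    · rw [dist_def_of_ne h, dist_def_of_ne (Ne.symm h), PiNat.firstDiff_comm]
  dist_triangle := dist_triangle'
  eq_of_dist_eq_zero := by
    intro A B hAB
    by_contra h
    rw [dist_def_of_ne h] at hAB
    have := card_pos A
    have : (0 : ℝ) < ((C.card : ℝ)⁻¹) ^ (PiNat.firstDiff A.letter B.letter + 1) := by
      positivity
    exact this.ne' hAB

/-- `ω = ω₁ω₂⋯` is a path of the tree labelled by `A`: `ω_k ∈ {0, a_k}` for every `k`. -/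
def IsPath (A : SpecialLabel C) (ω : ℕ → ℤ) : Prop :=
  ∀ k, ω k = 0 ∨ ω k = (A.letter k : ℤ)

/-- `Λ(A) = {∑_{k=1}^n 4^{k-1} ω_k : ω_k ∈ {0, a_k}, n ≥ 1}`. -/
def finiteExpansions (A : SpecialLabel C) : Set ℤ :=
  {l | ∃ ω : ℕ → ℤ, A.IsPath ω ∧ ∃ n : ℕ, 1 ≤ n ∧ l = ∑ k ∈ Finset.range n, 4 ^ k * ω k}

/-- `Λ_I(A)`: the integers `l` for which there is a path `ω` with
`l ≡ ∑_{k=1}^n 4^{k-1} ω_k (mod 4^n)` for all `n ≥ 1`. -/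
def allExpansions (A : SpecialLabel C) : Set ℤ :=
  {l | ∃ ω : ℕ → ℤ, A.IsPath ω ∧
    ∀ n : ℕ, 1 ≤ n → l ≡ ∑ k ∈ Finset.range n, 4 ^ k * ω k [ZMOD 4 ^ n]}

end SpecialLabel

/-- `N(C) = {A ∈ C^∞ : Λ(A) ≠ Λ_I(A)}`. -/
def exceptionalLabels (C : Finset ℤ) : Set (SpecialLabel C) :=
  {A | A.finiteExpansions ≠ A.allExpansions}

/-! Follow an expansion of `λ` through its remainders `x k`, where `x k = w k + 4 * x (k + 1)`.
Since labels are odd, parity forces each digit, so `λ` has a finite expansion iff some remainder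
vanishes. Hence `A` is exceptional iff its digits drive a walk that avoids `0` forever
(`mem_exceptionalLabels_iff`). For `{1, -1}` such a walk would shrink indefinitely. For `{1, 3}` it
must end at the fixed point `-1`, which requires the letter `3` at every step. For `{1, 4 ^ (r + 1)
- 1}` the cycle `-4 ^ r, …, -4, -1` constrains one letter in `r + 1`; reading the others as binary
digits maps the exceptional set onto `[0, 1]` with Hölder exponent `r / (r + 1)`, which bounds the
dimension below. -/

theorem CongrOneThree.odd {C : Finset ℤ} (hC : CongrOneThree C) {c : ℤ} (hc : c ∈ C) : Odd c := by
  have h : c % 4 ∈ C.image (fun c => c % 4) := Finset.mem_image_of_mem _ hc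
  rw [show C.image (fun c => c % 4) = {1, 3} from hC] at h
  simp only [Finset.mem_insert, Finset.mem_singleton] at h
  rw [Int.odd_iff]
  omega

/-- Paths with odd labels are determined by the residues of the integers they expand: if `x 0` has a
finite expansion of length `n`, then the remainder `x n` along any expansion vanishes. -/
theorem remainder_eq_zero_of_eq_sum (n : ℕ) (a w v x : ℕ → ℤ) (ha : ∀ k, Odd (a k))
    (hw : ∀ k, w k = 0 ∨ w k = a k) (hv : ∀ k, v k = 0 ∨ v k = a k)
    (hx : ∀ k, x k = w k + 4 * x (k + 1)) (h : x 0 = ∑ k ∈ Finset.range n, 4 ^ k * v k) :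
    x n = 0 := by
  induction n generalizing a w v x with
  | zero => simpa using h
  | succ n ih =>
    refine ih (fun k => a (k + 1)) (fun k => w (k + 1)) (fun k => v (k + 1)) (fun k => x (k + 1))
      (fun k => ha _) (fun k => hw _) (fun k => hv _) (fun k => hx _) ?_
    rw [Finset.sum_range_succ'] at h
    simp only [pow_succ', mul_assoc, ← Finset.mul_sum, pow_zero, one_mul] at h
    have h0 := hx 0
    obtain ⟨t, ht⟩ := ha 0
    -- `w 0` and `v 0` have the parity of `x 0`, so they agree; cancelling them leaves a multiple of
    -- `4` on each side.
    rcases hw 0 with h1 | h1 <;> rcases hv 0 with h2 | h2 <;> simp only [zero_add] at * <;> omega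

theorem eq_sum_add_of_remainder {w x : ℕ → ℤ} (hx : ∀ k, x k = w k + 4 * x (k + 1)) (n : ℕ) :
    x 0 = ∑ k ∈ Finset.range n, 4 ^ k * w k + 4 ^ n * x n := by
  induction n with
  | zero => simp
  | succ n ih =>
    rw [ih, Finset.sum_range_succ, hx n]
    ring

namespace SpecialLabel

variable {C : Finset ℤ}

theorem finiteExpansions_subset_allExpansions (A : SpecialLabel C) :
    A.finiteExpansions ⊆ A.allExpansions := by
  rintro l ⟨w, hw, n, -, rfl⟩
  refine ⟨fun k => if k < n then w k else 0, fun k => ?_, fun m _ => ?_⟩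
  · by_cases hk : k < n
    · simpa [hk] using hw k
    · simp [hk]
  · have key : ∀ N, n ≤ N → ∑ k ∈ Finset.range n, 4 ^ k * w k =
        ∑ k ∈ Finset.range N, 4 ^ k * (if k < n then w k else 0) := by
      intro N hN
      rw [← Finset.sum_subset (Finset.range_mono hN)]
      · exact Finset.sum_congr rfl fun k hk => by rw [if_pos (Finset.mem_range.1 hk)]
      · intro k _ hk
        rw [if_neg (by simpa using hk), mul_zero]
    rw [key (max n m) (le_max_left _ _),
      ← Finset.sum_range_add_sum_Ico _ (le_max_right n m)]
    refine (Int.modEq_iff_dvd.2 ?_)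
    rw [sub_add_cancel_left, dvd_neg]
    exact Finset.dvd_sum fun k hk =>
      Dvd.dvd.mul_right (pow_dvd_pow _ (Finset.mem_Ico.1 hk).1) _

/-- The label obtained by writing the letter `c` in front of `A`. -/
def cons (c : C) (A : SpecialLabel C) : SpecialLabel C where
  letter k := Nat.casesOn k c A.letter

theorem cons_injective (c : C) : Function.Injective (cons c) := by
  intro A B h
  ext k
  exact congrArg (fun D : SpecialLabel C => (D.letter (k + 1) : ℤ)) h

end SpecialLabel

open SpecialLabel
open scoped NNReal ENNReal

/-- A label is exceptional iff some expansion along it has remainders which never vanish. -/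
theorem mem_exceptionalLabels_iff {C : Finset ℤ} (hC : CongrOneThree C) {A : SpecialLabel C} :
    A ∈ exceptionalLabels C ↔
      ∃ w x : ℕ → ℤ, A.IsPath w ∧ (∀ k, x k = w k + 4 * x (k + 1)) ∧ ∀ k, x k ≠ 0 := by
  constructor
  · intro hA
    obtain ⟨l, ⟨w, hw, hl⟩, hl'⟩ : ∃ l, l ∈ A.allExpansions ∧ l ∉ A.finiteExpansions := by
      by_contra! h
      exact hA (A.finiteExpansions_subset_allExpansions.antisymm h)
    have hdvd : ∀ n, ∃ y, l - ∑ k ∈ Finset.range n, 4 ^ k * w k = 4 ^ n * y := by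
      intro n
      rcases n.eq_zero_or_pos with rfl | hn
      · exact ⟨l, by simp⟩
      · exact (hl n hn).symm.dvd
    choose x hx using hdvd
    refine ⟨w, x, hw, fun n => ?_, fun n hn => hl' ?_⟩
    · have h4 : (4 : ℤ) ^ n ≠ 0 := by positivity
      apply mul_left_cancel₀ h4
      have := hx (n + 1)
      rw [Finset.sum_range_succ, pow_succ] at this
      linear_combination this - hx n
    · have h := hx n
      rw [hn, mul_zero, sub_eq_zero] at h
      rcases n.eq_zero_or_pos with rfl | hpos
      -- Here `l = 0`; finite expansions have length at least `1`, so a single zero digit is used.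
      · exact ⟨fun _ => 0, fun _ => Or.inl rfl, 1, le_rfl, by simpa using h⟩
      · exact ⟨w, hw, n, hpos, h⟩
  · rintro ⟨w, x, hw, hx, hne⟩ hA
    have hmem : x 0 ∈ A.allExpansions := by
      refine ⟨w, hw, fun n _ => ?_⟩
      rw [eq_sum_add_of_remainder hx n]
      exact (Int.modEq_iff_dvd.2 (by simp))
    rw [← hA] at hmem
    obtain ⟨v, hv, n, -, h⟩ := hmem
    exact hne n (remainder_eq_zero_of_eq_sum n _ w v x (fun k => hC.odd (A.letter k).2) hw hv hx h)

/-- A zero digit placed in front, with first remainder `4 * x 0`, keeps the walk away from `0`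
whatever the new letter is. -/
theorem cons_mem_exceptionalLabels {C : Finset ℤ} (hC : CongrOneThree C) {A : SpecialLabel C}
    (hA : A ∈ exceptionalLabels C) (c : C) : cons c A ∈ exceptionalLabels C := by
  rw [mem_exceptionalLabels_iff hC] at hA ⊢
  obtain ⟨w, x, hw, hx, hne⟩ := hA
  refine ⟨fun k => Nat.casesOn k 0 w, fun k => Nat.casesOn k (4 * x 0) x, ?_, ?_, ?_⟩
  · rintro (_ | k)
    · exact Or.inl rfl
    · exact hw k
  · rintro (_ | k)
    · simp
    · exact hx k
  · rintro (_ | k)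
    · simpa using hne 0
    · exact hne k

/-- Prefixing `c` is an injective self-map of the exceptional set that misses every label starting
with another letter `d`, which is impossible on a nonempty finite set. -/
theorem exceptionalLabels_infinite {C : Finset ℤ} (hC : CongrOneThree C)
    (hne : (exceptionalLabels C).Nonempty) : (exceptionalLabels C).Infinite := by
  have hres : ∀ r ∈ ({1, 3} : Finset ℤ), ∃ c ∈ C, c % 4 = r := by
    intro r hr
    rw [← show C.image (fun c => c % 4) = {1, 3} from hC] at hr
    simpa using hr
  obtain ⟨c, hc, hc1⟩ := hres 1 (by simp)
  obtain ⟨d, hd, hd3⟩ := hres 3 (by simp)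
  intro hfin
  have : Finite (exceptionalLabels C) := hfin
  let f : exceptionalLabels C → exceptionalLabels C :=
    fun A => ⟨cons ⟨c, hc⟩ A, cons_mem_exceptionalLabels hC A.2 _⟩
  have hinj : Function.Injective f := fun A B h =>
    Subtype.ext (cons_injective _ (congrArg Subtype.val h))
  obtain ⟨A, hA⟩ := hne
  obtain ⟨B, hB⟩ := Finite.injective_iff_surjective.1 hinj
    ⟨cons ⟨d, hd⟩ A, cons_mem_exceptionalLabels hC hA _⟩
  have hcd : c = d :=
    congrArg (fun D : exceptionalLabels C => (D.1.letter 0 : ℤ)) hB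
  omega

/-! ### The digit set `{1, -1}`: no exceptional labels -/

theorem congrOneThree_one_neg_one : CongrOneThree {1, -1} := by
  unfold CongrOneThree
  decide

theorem exceptionalLabels_one_neg_one : exceptionalLabels {1, -1} = ∅ := by
  refine Set.eq_empty_of_forall_notMem fun A hA => ?_
  obtain ⟨w, x, hw, hx, hne⟩ := (mem_exceptionalLabels_iff congrOneThree_one_neg_one).1 hA
  -- `|x (k + 1)| ≤ (|x k| + 1) / 4 < |x k|` as long as `x k ≠ 0`.
  have hdec : ∀ k, (x (k + 1)).natAbs < (x k).natAbs := by
    intro k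
    have h1 := hx k
    have h2 := hne k
    have h3 : (A.letter k : ℤ) = 1 ∨ (A.letter k : ℤ) = -1 := by
      simpa only [Finset.mem_insert, Finset.mem_singleton] using (A.letter k).2
    rcases hw k with h | h <;> omega
  have hbound : ∀ k, (x k).natAbs + k ≤ (x 0).natAbs := by
    intro k
    induction k with
    | zero => simp
    | succ k ih =>
      have := hdec k
      omega
  have := hbound ((x 0).natAbs + 1)
  omega

/-! ### The digit set `{1, 3}`: countably many exceptional labels -/

theorem congrOneThree_one_three : CongrOneThree {1, 3} := by
  unfold CongrOneThree
  decide

theorem letter_one_three (A : SpecialLabel {1, 3}) (k : ℕ) :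
    (A.letter k : ℤ) = 1 ∨ (A.letter k : ℤ) = 3 := by
  simpa only [Finset.mem_insert, Finset.mem_singleton] using (A.letter k).2

theorem exceptionalLabels_one_three_nonempty : (exceptionalLabels {1, 3}).Nonempty := by
  refine ⟨⟨fun _ => ⟨3, by simp⟩⟩, (mem_exceptionalLabels_iff congrOneThree_one_three).2
    ⟨fun _ => 3, fun _ => -1, fun _ => Or.inr rfl, fun _ => by norm_num, fun _ => by norm_num⟩⟩

theorem eventually_letter_eq_three {A : SpecialLabel {1, 3}} (hA : A ∈ exceptionalLabels {1, 3}) :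
    ∃ N, ∀ k, N ≤ k → (A.letter k : ℤ) = 3 := by
  obtain ⟨w, x, hw, hx, hne⟩ := (mem_exceptionalLabels_iff congrOneThree_one_three).1 hA
  -- `|x (k + 1)| ≤ (|x k| + 3) / 4` is a strict decrease once `|x k| > 1`; from `1` only `0` is
  -- reachable, and from `-1` only `-1 = 3 + 4 * (-1)`.
  have hstep : ∀ k, (x k = -1 ∧ x (k + 1) = -1 ∧ (A.letter k : ℤ) = 3) ∨
      (x (k + 1)).natAbs < (x k).natAbs := by
    intro k
    have h1 := hx k
    have h2 := hne k
    have h3 := hne (k + 1)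
    rcases hw k with h | h <;> rcases letter_one_three A k with h4 | h4 <;> omega
  have hex : ∃ N, x N = -1 := by
    by_contra! hall
    have hbound : ∀ k, (x k).natAbs + k ≤ (x 0).natAbs := by
      intro k
      induction k with
      | zero => simp
      | succ k ih =>
        rcases hstep k with h | h
        · exact absurd h.1 (hall k)
        · omega
    have := hbound ((x 0).natAbs + 1)
    omega
  obtain ⟨N, hN⟩ := hex
  have hfix : ∀ k, x k = -1 → x (k + 1) = -1 ∧ (A.letter k : ℤ) = 3 := by
    intro k hk
    have := hne (k + 1)
    rcases hstep k with h | h <;> omega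
  have hall : ∀ k, N ≤ k → x k = -1 := by
    intro k hk
    induction k, hk using Nat.le_induction with
    | base => exact hN
    | succ k _ ih => exact (hfix k ih).1
  exact ⟨N, fun k hk => (hfix k (hall k hk)).2⟩

/-- An exceptional label is determined by the finite set of positions of its letter `1`. -/
theorem exceptionalLabels_one_three_countable : (exceptionalLabels {1, 3}).Countable := by
  have hfin : ∀ A : exceptionalLabels {1, 3}, {k | (A.1.letter k : ℤ) = 1}.Finite := by
    intro A
    obtain ⟨N, hN⟩ := eventually_letter_eq_three A.2
    refine (Set.finite_lt_nat N).subset fun k hk => ?_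
    by_contra h
    have h3 := hN k (not_lt.1 h)
    have h1 : (A.1.letter k : ℤ) = 1 := hk
    omega
  have hinj : Function.Injective fun A : exceptionalLabels {1, 3} => (hfin A).toFinset := by
    intro A B h
    have h' : {k | (A.1.letter k : ℤ) = 1} = {k | (B.1.letter k : ℤ) = 1} :=
      Set.Finite.toFinset_inj.1 h
    refine Subtype.ext (SpecialLabel.ext (funext fun k => Subtype.ext ?_))
    have hk : (A.1.letter k : ℤ) = 1 ↔ (B.1.letter k : ℤ) = 1 := Set.ext_iff.1 h' k
    rcases letter_one_three A.1 k with hA | hA <;> rcases letter_one_three B.1 k with hB | hB <;>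
      omega
  exact Set.countable_coe_iff.1 hinj.countable

/-! ### The digit sets `{1, 4 ^ (r + 1) - 1}`: dimension close to `1` -/

theorem three_mul_geom_sum_four (n : ℕ) :
    3 * ∑ k ∈ Finset.range n, (4 : ℤ) ^ k = 4 ^ n - 1 := by
  induction n with
  | zero => simp
  | succ n ih =>
    rw [Finset.sum_range_succ, mul_add, ih, pow_succ]
    ring

theorem congrOneThree_one_pow_sub_one (r : ℕ) : CongrOneThree {1, 4 ^ (r + 1) - 1} := by
  have h : ((4 : ℤ) ^ (r + 1) - 1) % 4 = 3 := by
    rw [pow_succ]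
    omega
  simp [CongrOneThree, Finset.image_insert, h]

/-- Only the letters at the positions congruent to `r` modulo `r + 1` are needed to keep the
remainders in the cycle `-4 ^ r, -4 ^ (r - 1), …, -1`. -/
theorem mem_exceptionalLabels_of_periodic {r : ℕ} {A : SpecialLabel {1, 4 ^ (r + 1) - 1}}
    (hA : ∀ k, k % (r + 1) = r → (A.letter k : ℤ) = 4 ^ (r + 1) - 1) :
    A ∈ exceptionalLabels {1, 4 ^ (r + 1) - 1} := by
  refine (mem_exceptionalLabels_iff (congrOneThree_one_pow_sub_one r)).2
    ⟨fun k => if k % (r + 1) = r then 4 ^ (r + 1) - 1 else 0,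
      fun k => -4 ^ (r - k % (r + 1)), fun k => ?_, fun k => ?_, fun k => by simp⟩
  · by_cases hk : k % (r + 1) = r
    · right
      simp [hk, hA k hk]
    · simp [hk]
  · have hlt : k % (r + 1) < r + 1 := Nat.mod_lt k r.succ_pos
    by_cases hk : k % (r + 1) = r
    · have h0 : (k + 1) % (r + 1) = 0 := by
        rw [Nat.add_mod, hk]
        rcases r with _ | r <;> simp
      -- The cycle closes because `-1 = (4 ^ (r + 1) - 1) + 4 * (-4 ^ r)`.
      simp only [hk, h0, if_true]
      simp only [Nat.sub_self, Nat.sub_zero, pow_succ]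
      ring
    · have h1 : (k + 1) % (r + 1) = k % (r + 1) + 1 := by
        rw [Nat.add_mod, Nat.mod_eq_of_lt (a := 1) (by omega), Nat.mod_eq_of_lt]
        omega
      obtain ⟨s, hs⟩ : ∃ s, r = k % (r + 1) + 1 + s := Nat.exists_eq_add_of_le (by omega)
      simp only [if_neg hk]
      rw [h1, show r - k % (r + 1) = s + 1 by omega,
        show r - (k % (r + 1) + 1) = s by omega]
      ring

/-- The increasing enumeration of the positions not congruent to `r` modulo `r + 1`. -/
def freePosition (r j : ℕ) : ℕ := j + j / r

theorem freePosition_mod_ne {r : ℕ} (hr : 1 ≤ r) (j : ℕ) : freePosition r j % (r + 1) ≠ r := by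
  have h : freePosition r j = j % r + (r + 1) * (j / r) := by
    have := Nat.mod_add_div j r
    rw [freePosition]
    linarith
  have hlt := Nat.mod_lt j hr
  rw [h, Nat.add_mul_mod_self_left, Nat.mod_eq_of_lt (by omega)]
  exact hlt.ne

theorem freePosition_injective (r : ℕ) : Function.Injective (freePosition r) := by
  refine StrictMono.injective fun i j hij => ?_
  have := Nat.div_le_div_right (c := r) hij.le
  unfold freePosition
  omega

/-- Free positions have density `r / (r + 1)`: `j + j / r ≤ j * (r + 1) / r < n`. -/
theorem freePosition_lt {r : ℕ} (hr : 1 ≤ r) {j n : ℕ} (h : (j : ℝ) < n * (r / (r + 1))) :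
    freePosition r j < n := by
  have h1 : j * (r + 1) < n * r := by
    have : (j : ℝ) * (r + 1) < n * r := by
      rw [mul_div_assoc', lt_div_iff₀ (by positivity)] at h
      exact h
    exact_mod_cast this
  have h2 : r * (j / r) ≤ j := Nat.mul_div_le j r
  refine lt_of_mul_lt_mul_right (a := r) ?_ (Nat.zero_le r)
  rw [freePosition]
  linarith

/-- The real number in `[0, 1]` whose binary digits record which of the letters of `A` at free
positions are equal to `1`. -/
noncomputable def freeDigitsReal (r : ℕ) {C : Finset ℤ} (A : SpecialLabel C) : ℝ :=
  Real.ofDigits (b := 2) fun j => if (A.letter (freePosition r j) : ℤ) = 1 then 1 else 0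

theorem dist_freeDigitsReal_le {r : ℕ} (hr : 1 ≤ r) {C : Finset ℤ} (hC : C.card = 2)
    (A B : SpecialLabel C) :
    dist (freeDigitsReal r A) (freeDigitsReal r B) ≤ 2 * dist A B ^ ((r : ℝ) / (r + 1)) := by
  have hα : (0 : ℝ) < (r : ℝ) / (r + 1) := by
    have : (0 : ℝ) < r := by exact_mod_cast hr
    positivity
  have hα1 : (r : ℝ) / (r + 1) ≤ 1 := (div_le_one (by positivity)).2 (by linarith)
  by_cases hAB : A = B
  · subst hAB
    simp only [dist_self]
    positivity
  set α : ℝ := (r : ℝ) / (r + 1)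
  set n := PiNat.firstDiff A.letter B.letter
  have hd : dist A B = (2 : ℝ) ^ (-((n : ℝ) + 1)) := by
    rw [dist_def_of_ne hAB, hC, Real.rpow_neg (by norm_num), inv_pow]
    norm_cast
  have h1 : dist (freeDigitsReal r A) (freeDigitsReal r B) ≤ (((2 : ℕ) : ℝ) ^ ⌈n * α⌉₊)⁻¹ := by
    refine Real.abs_ofDigits_sub_ofDigits_le fun j hj => ?_
    rw [PiNat.apply_eq_of_lt_firstDiff (freePosition_lt hr (Nat.lt_ceil.1 hj))]
  refine h1.trans ?_
  rw [hd, ← Real.rpow_mul (by norm_num), ← Real.rpow_natCast, ← Real.rpow_neg (by norm_num)]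
  -- The factor `2` absorbs the shift from `n` to `n + 1` in the metric, since `α ≤ 1`.
  calc (((2 : ℕ) : ℝ) ^ (-(⌈n * α⌉₊ : ℝ))) ≤ (2 : ℝ) ^ (1 + -((n : ℝ) + 1) * α) := by
        rw [Nat.cast_ofNat]
        refine Real.rpow_le_rpow_of_exponent_le (by norm_num) ?_
        have := Nat.le_ceil (n * α)
        linarith
    _ = 2 * (2 : ℝ) ^ (-((n : ℝ) + 1) * α) := by
        rw [Real.rpow_add (by norm_num), Real.rpow_one]

theorem holderOnWith_freeDigitsReal {r : ℕ} (hr : 1 ≤ r) {C : Finset ℤ} (hC : C.card = 2)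
    (S : Set (SpecialLabel C)) :
    HolderOnWith 2 ((r : ℝ≥0) / (r + 1)) (freeDigitsReal r) S := by
  intro A _ B _
  have h := dist_freeDigitsReal_le hr hC A B
  rw [edist_dist, edist_dist, ENNReal.ofReal_rpow_of_nonneg dist_nonneg (NNReal.coe_nonneg _)]
  refine (ENNReal.ofReal_le_ofReal h).trans_eq ?_
  rw [ENNReal.ofReal_mul (by norm_num)]
  simp

/-- Write the binary digits of `y` at the free positions and the letter `4 ^ (r + 1) - 1` at all the
others. -/
theorem Icc_subset_image_freeDigitsReal {r : ℕ} (hr : 1 ≤ r) :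
    Set.Icc (0 : ℝ) 1 ⊆
      freeDigitsReal r '' exceptionalLabels {1, 4 ^ (r + 1) - 1} := by
  intro y hy
  obtain ⟨d, -, rfl⟩ := Real.ofDigits_SurjOn one_lt_two hy
  have hne : (4 : ℤ) ^ (r + 1) - 1 ≠ 1 := by
    rw [pow_succ]
    omega
  classical
  let A : SpecialLabel {1, 4 ^ (r + 1) - 1} :=
    ⟨fun k => if ∃ j, freePosition r j = k ∧ d j = 1 then ⟨1, by simp⟩
      else ⟨4 ^ (r + 1) - 1, by simp⟩⟩
  refine ⟨A, mem_exceptionalLabels_of_periodic fun k hk => ?_, ?_⟩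
  · have : ¬ ∃ j, freePosition r j = k ∧ d j = 1 := by
      rintro ⟨j, rfl, -⟩
      exact freePosition_mod_ne hr j hk
    simp only [A, if_neg this]
  · refine congrArg Real.ofDigits (funext fun j => ?_)
    have hiff : (∃ i, freePosition r i = freePosition r j ∧ d i = 1) ↔ d j = 1 := by
      refine ⟨?_, fun h => ⟨j, rfl, h⟩⟩
      rintro ⟨i, hi, h⟩
      rwa [← freePosition_injective r hi]
    by_cases h : d j = 1
    · simp only [A, hiff, if_true, h]
    · simp only [A, hiff, if_neg h, if_neg hne]
      omega

/-- A Hölder map of exponent `α` multiplies dimension by at most `1 / α`, and here its image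
contains `[0, 1]`. -/
theorem le_dimH_exceptionalLabels {r : ℕ} (hr : 1 ≤ r) :
    (((r : ℝ≥0) / (r + 1) : ℝ≥0) : ℝ≥0∞) ≤
      dimH (exceptionalLabels {1, 4 ^ (r + 1) - 1}) := by
  have hα : 0 < (r : ℝ≥0) / (r + 1) := by
    have : (0 : ℝ≥0) < r := by exact_mod_cast hr
    positivity
  have hcard : ({1, 4 ^ (r + 1) - 1} : Finset ℤ).card = 2 := by
    refine Finset.card_pair ?_
    rw [pow_succ]
    omega
  have h1 : dimH (Set.Icc (0 : ℝ) 1) = 1 := by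
    rw [Real.dimH_of_nonempty_interior (by simp), Module.finrank_self, Nat.cast_one]
  have h2 := h1.symm.le.trans ((dimH_mono (Icc_subset_image_freeDigitsReal hr)).trans
    ((holderOnWith_freeDigitsReal hr hcard _).dimH_image_le hα))
  have h3 := ENNReal.mul_le_of_le_div h2
  rwa [one_mul] at h3

theorem theorem3p5 :
    (∃ C : Finset ℤ, CongrOneThree C ∧ exceptionalLabels C = ∅) ∧
    (∀ C : Finset ℤ, CongrOneThree C →
      (exceptionalLabels C).Nonempty → (exceptionalLabels C).Infinite) ∧
    (CongrOneThree {1, 3} ∧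
      (exceptionalLabels {1, 3}).Infinite ∧ (exceptionalLabels {1, 3}).Countable) ∧
    (∀ ε : ℝ, 0 < ε → ∃ (r : ℕ) (C : Finset ℤ), 1 ≤ r ∧
      C = {1, 3 * ∑ n ∈ Finset.range (r + 1), (4 : ℤ) ^ n} ∧ CongrOneThree C ∧
      ENNReal.ofReal (1 - ε) < dimH (exceptionalLabels C)) := by
  refine ⟨⟨_, congrOneThree_one_neg_one, exceptionalLabels_one_neg_one⟩,
    fun C hC => exceptionalLabels_infinite hC,
    ⟨congrOneThree_one_three,
      exceptionalLabels_infinite congrOneThree_one_three exceptionalLabels_one_three_nonempty,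
      exceptionalLabels_one_three_countable⟩, fun ε hε => ?_⟩
  obtain ⟨n, hn⟩ := exists_nat_one_div_lt hε
  -- With `r = n + 1`, `r / (r + 1) = 1 - 1 / (n + 2) > 1 - ε`.
  refine ⟨n + 1, {1, 4 ^ (n + 1 + 1) - 1}, by omega, by rw [three_mul_geom_sum_four],
    congrOneThree_one_pow_sub_one _, lt_of_lt_of_le ?_ (le_dimH_exceptionalLabels (by omega))⟩
  rw [← ENNReal.ofReal_coe_nnreal, ENNReal.ofReal_lt_ofReal_iff (NNReal.coe_pos.2 (by positivity))]
  have h1 : (0 : ℝ) < (n : ℝ) + 1 := by positivity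
  have h2 : 1 / ((n : ℝ) + 1 + 1) ≤ 1 / ((n : ℝ) + 1) :=
    one_div_le_one_div_of_le h1 (by linarith)
  have h3 : ((n : ℝ) + 1) / ((n : ℝ) + 1 + 1) = 1 - 1 / ((n : ℝ) + 1 + 1) := by
    field_simp
    ring
  push_cast
  linarith
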